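/- **Setting.** Let $\mathbb R^N=\mathbb R^{N_1}\times\cdots\times\mathbb R^{N_n}$ with the standard inner product, and write $x=(x_1,\dots,x_n)$ with $x_i\in\mathbb R^{N_i}$. Let $f:\mathbb R^N\to\mathbb R\cup\{\infty\}$ be a standard self-concordant function: $f$ is closed and convex, its domain $\operatorname{dom} f$ is open, $f$ is three times continuously differentiable on $\operatorname{dom} f$, and $|\psi'''(0)|\le 2\,\psi''(0)^{3/2}$ for all $x\in\operatorname{dom} f$ and $u\in\mathbb R^N$, where $\psi(t)=f(x+tu)$. Let $g(x)=\sum_{i=1}^n g_i(x_i)$, where each $g_i:\mathbb R^{N_i}\to\mathbb R\cup\{\infty\}$ is proper, closed and convex, and let $F=f+g$. Assume that $\nabla^2 f(x)$ is positive definite for every $x\in\operatorname{dom}F$ and that $F$ has a unique minimizer $x^*$; put $F^*=F(x^*)$. Let $\nabla_i f(x)$ and $\nabla^2_{ii}f(x)$ be the subvector of the gradient and the diagonal block of the Hessian that correspond to $x_i$, and for $x\in\operatorname{dom}F$ and $y,z\in\mathbb R^{N_i}$ put $$\|y\|_{x_i}=\sqrt{\langle y,\nabla^2_{ii}f(x)y\rangle},\qquad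 \|z\|^*_{x_i}=\sqrt{\langle z,(\nabla^2_{ii}f(x))^{-1}z\rangle}.$$ **RBPDN method** (randomized block proximal damped Newton). Let $x^0\in\operatorname{dom}F$, $\eta\in[0,1/4]$, and $p_1,\dots,p_n>0$ with $\sum_i p_i=1$. At iteration $k=0,1,2,\dots$: 1. Pick $\imath\in\{1,\dots,n\}$ at random with probability $p_\imath$, independently of the earlier picks. 2. Find an approximate solution $d_\imath$ of the $\imath$-th block proximal Newton subproblem at $x^k$, in the sense that for some $v_\imath$ $$-v_\imath\in\nabla_\imath f(x^k)+\nabla^2_{\imath\imath}f(x^k)\,d_\imath+\partial g_\imath(x^k_\imath+d_\imath),\qquad \|v_\imath\|^*_{x^k_\imath}\le\eta\,\|d_\imath\|_{x^k_\imath}.$$ The direction $d_\imath$ is determined by $\imath$ and by the blocks picked before iteration $k$ (for example, it is a function $d_\imath(x^k)$ of the current iterate). 3. Set $x^{k+1}_j=x^k_j$ for $j\ne\imath$ and $x^{k+1}_\imath=x^k_\imath+d_\imath/(1+\|d_\imath\|_{x^k_\imath})$. **Theorem 4.1.** Assume that $g$ is Lipschitz continuous on the level set $\mathcal S(x^0)=\{x: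 F(x)\le F(x^0)\}$. Then every iterate $x^k$ lies in $\operatorname{dom}F$, each $F(x^k)$ is integrable, and $$\lim_{k\to\infty}\mathbb E[F(x^k)]=F^*.$$ -/

import Mathlib

open Filter Topology MeasureTheory ProbabilityTheory

namespace RBPDN

/-! ### Extended-real-valued convex functions

Functions with values in `ℝ ∪ {∞}` are modelled by `V → WithTop ℝ`. -/

section Extended

variable {V : Type*}

/-- The effective domain `{x : f x < ∞}`. -/
def dom (f : V → WithTop ℝ) : Set V := {x | f x ≠ ⊤}

/-- The real value of an extended-real-valued function. It is meaningful on `dom f` only. -/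
def realVal (f : V → WithTop ℝ) (x : V) : ℝ := (f x).untopD 0

/-- The epigraph `{(x, t) : f x ≤ t}`. -/
def epigraph (f : V → WithTop ℝ) : Set (V × ℝ) := {q | f q.1 ≤ (q.2 : WithTop ℝ)}

/-- A closed convex function: its epigraph is closed and convex. -/
structure IsClosedConvex [NormedAddCommGroup V] [NormedSpace ℝ V] (f : V → WithTop ℝ) : Prop where
  closed : IsClosed (epigraph f)
  convex : Convex ℝ (epigraph f)

/-- A proper closed convex function. -/
structure IsProperClosedConvex [NormedAddCommGroup V] [NormedSpace ℝ V]
    (f : V → WithTop ℝ) : Prop extends IsClosedConvex f where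
  proper : (dom f).Nonempty

/-- The convex subdifferential (empty outside the domain). -/
def subdiff [NormedAddCommGroup V] [InnerProductSpace ℝ V] (g : V → WithTop ℝ) (z : V) : Set V :=
  {s | z ∈ dom g ∧ ∀ y, g z + ((inner ℝ s (y - z) : ℝ) : WithTop ℝ) ≤ g y}

/-- `f` is self-concordant with parameter `M`: it is closed and convex, its domain is open, it is
three times continuously differentiable there, and along every line `ψ t = f (x + t u)` through a
point `x` of the domain, `|ψ'''(0)| ≤ M ψ''(0) ^ (3/2)`. -/
structure IsSelfConcordant [NormedAddCommGroup V] [NormedSpace ℝ V]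
    (M : ℝ) (f : V → WithTop ℝ) : Prop extends IsClosedConvex f where
  isOpen_dom : IsOpen (dom f)
  contDiffOn : ContDiffOn ℝ 3 (realVal f) (dom f)
  third_deriv_le : ∀ x ∈ dom f, ∀ u : V,
    |iteratedDeriv 3 (fun t : ℝ => realVal f (x + t • u)) 0|
      ≤ M * (iteratedDeriv 2 (fun t : ℝ => realVal f (x + t • u)) 0) ^ (3 / 2 : ℝ)

/-- Standard self-concordant: parameter `2`. -/
def IsStandardSelfConcordant [NormedAddCommGroup V] [NormedSpace ℝ V]
    (f : V → WithTop ℝ) : Prop := IsSelfConcordant 2 f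

end Extended

/-! ### Block vectors -/

/-- The `i`-th block space `ℝ^{N i}`. -/
abbrev Block {n : ℕ} (N : Fin n → ℕ) (i : Fin n) : Type := EuclideanSpace ℝ (Fin (N i))

/-- The full space `ℝ^{N 1} × ⋯ × ℝ^{N n}` with the Euclidean inner product. -/
abbrev BlockVec {n : ℕ} (N : Fin n → ℕ) : Type := PiLp 2 (fun i => Block N i)

noncomputable section

variable {n : ℕ} {N : Fin n → ℕ}

/-- The separable function `g x = ∑ i, g_i (x_i)`. -/
def separable (g : ∀ i, Block N i → WithTop ℝ) (x : BlockVec N) : WithTop ℝ := ∑ i, g i (x i)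

/-- The objective `F = f + g`. -/
def objective (f : BlockVec N → WithTop ℝ) (g : ∀ i, Block N i → WithTop ℝ) (x : BlockVec N) :
    WithTop ℝ := f x + separable g x

/-- The level set `{x : F x ≤ F x⁰}`. -/
def levelSet (f : BlockVec N → WithTop ℝ) (g : ∀ i, Block N i → WithTop ℝ) (x0 : BlockVec N) :
    Set (BlockVec N) := {x | objective f g x ≤ objective f g x0}

/-- `x` is the unique optimal solution of the minimization of `F`. -/
def IsUniqueMinimizer (F : BlockVec N → WithTop ℝ) (x : BlockVec N) : Prop :=
  (∀ y, F x ≤ F y) ∧ ∀ z, (∀ y, F z ≤ F y) → z = x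

/-- The gradient `∇ f(x)`, used at points of the open set `dom f`. -/
def grad (f : BlockVec N → WithTop ℝ) (x : BlockVec N) : BlockVec N := gradient (realVal f) x

/-- The Hessian `∇² f(x)` as a linear operator: the derivative of the gradient. -/
def hess (f : BlockVec N → WithTop ℝ) (x : BlockVec N) : BlockVec N →L[ℝ] BlockVec N :=
  fderiv ℝ (grad f) x

/-- The embedding of the `i`-th block space, filling the other blocks with zeros. -/
def embed (i : Fin n) (y : Block N i) : BlockVec N := WithLp.toLp 2 (Pi.single i y)

/-- The diagonal block `∇²_{ii} f(x)` of the Hessian. -/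
def blockHess (f : BlockVec N → WithTop ℝ) (x : BlockVec N) (i : Fin n) :
    Block N i →L[ℝ] Block N i :=
  LinearMap.toContinuousLinearMap
    { toFun := fun y => (hess f x (embed i y)) i
      map_add' := fun y z => by simp [embed, Pi.single_add]
      map_smul' := fun c y => by simp [embed, Pi.single_smul] }

/-- The local norm `‖y‖_{x_i} = √⟨y, ∇²_{ii} f(x) y⟩` on the `i`-th block. -/
def blockNorm (f : BlockVec N → WithTop ℝ) (x : BlockVec N) (i : Fin n) (y : Block N i) : ℝ :=
  Real.sqrt (inner ℝ y (blockHess f x i y))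

/-- The dual local norm `‖z‖*_{x_i} = √⟨z, (∇²_{ii} f(x))⁻¹ z⟩` on the `i`-th block. -/
def blockDualNorm (f : BlockVec N → WithTop ℝ) (x : BlockVec N) (i : Fin n) (z : Block N i) : ℝ :=
  Real.sqrt (inner ℝ z ((blockHess f x i).inverse z))

/-! ### The method -/

/-- `d` is an approximate solution, with inexactness `η`, of the `i`-th block subproblem at `x`:
for some `v`, `-v ∈ ∇_i f(x) + ∇²_{ii} f(x) d + ∂g_i(x_i + d)` and `‖v‖*_{x_i} ≤ η ‖d‖_{x_i}`. -/
def IsInexactDirection (f : BlockVec N → WithTop ℝ) (g : ∀ i, Block N i → WithTop ℝ) (η : ℝ)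
    (x : BlockVec N) (i : Fin n) (d : Block N i) : Prop :=
  ∃ v : Block N i,
    (∃ s ∈ subdiff (g i) (x i + d), -v = (grad f x) i + blockHess f x i d + s) ∧
    blockDualNorm f x i v ≤ η * blockNorm f x i d

/-- The damped step in block `i`: `x_i` is replaced by `x_i + d / (1 + ‖d‖_{x_i})`, and the other
blocks are kept. -/
def blockStep (f : BlockVec N → WithTop ℝ) (x : BlockVec N) (i : Fin n) (d : Block N i) :
    BlockVec N :=
  WithLp.toLp 2 (Function.update x.ofLp i (x i + (1 / (1 + blockNorm f x i d)) • d))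

/-- The iterate reached from `x0` when the blocks in the list have been picked (the most recent
one first). The direction `d h i` is the one that is computed if block `i` is picked after the
history `h`; a direction `d_i(x)` that is a function of the current iterate is a special case. -/
def iterate (f : BlockVec N → WithTop ℝ) (x0 : BlockVec N)
    (d : List (Fin n) → ∀ i : Fin n, Block N i) : List (Fin n) → BlockVec N
  | [] => x0
  | i :: h => blockStep f (iterate f x0 d h) i (d h i)

/-- The blocks picked in the first `k` iterations, the most recent one first. -/
def history {Ω : Type*} (idx : ℕ → Ω → Fin n) (ω : Ω) : ℕ → List (Fin n)
  | 0 => []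
  | k + 1 => idx k ω :: history idx ω k

end

end RBPDN

/-!
The proof combines a sufficient decrease of each step with a bound of the optimality gap by the
same quantity.

*Decrease.* Along a line, self-concordance is the differential inequality `q' ≤ 2 q ^ (3/2)` for
`q = ψ''`. Comparison with the solutions `(r / (1 - r t)) ^ 2` shows that a step of local length
`r < 1` stays in `dom f` and costs at most `-r - log (1 - r)` above the linearization of `f`
(`dikin`). For an inexact direction of local norm `λ`, the damped step has `r = λ / (1 + λ)`;
together with the subgradient inequality for `g_i` at `x_i + d_i` and the convexity of `g_i`, this
gives `F(x⁺) ≤ F(x) - λ ^ 2 / (4 (1 + λ))` when `η ≤ 1/4` (`blockStep_decrease`). In particular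
no iterate leaves the level set of the starting point.

*Gap.* A closed convex function with a unique minimizer has compact sublevel sets
(`isCompact_sublevel`). On the level set the gradient is therefore bounded, and the Hessian is
uniformly bounded and uniformly positive definite. With the Lipschitz condition, the gradient
inequality for `f` and the subgradients of the `g_i` at `x_i + d_i` give
`F(x) - F* ≤ C ∑ λ_i` (`exists_gap_le`).

*Expectation.* Hence, given the history, the mean of the gap `δ` drops by at least `c δ ^ 2` in each
iteration. As the pick is independent of the history, Jensen's inequality turns this into
`a (k + 1) ≤ a k - c (a k) ^ 2` for the expected gaps, which forces `a k → 0`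
(`tendsto_integral_history`).
-/

namespace RBPDN

/-! ### Extended-real-valued convex functions -/

section Extended

variable {V : Type*}

theorem coe_realVal {f : V → WithTop ℝ} {x : V} (hx : x ∈ dom f) :
    ((realVal f x : ℝ) : WithTop ℝ) = f x := by
  obtain ⟨r, hr⟩ := WithTop.ne_top_iff_exists.1 (show f x ≠ ⊤ from hx)
  simp [realVal, ← hr]

theorem mem_dom_of_le {f : V → WithTop ℝ} {x : V} {r : ℝ} (h : f x ≤ r) : x ∈ dom f :=
  ne_top_of_le_ne_top WithTop.coe_ne_top h

theorem le_coe_iff {f : V → WithTop ℝ} {x : V} {r : ℝ} :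
    f x ≤ r ↔ x ∈ dom f ∧ realVal f x ≤ r := by
  constructor
  · intro h
    have hx := mem_dom_of_le h
    rw [← coe_realVal hx] at h
    exact ⟨hx, by exact_mod_cast h⟩
  · rintro ⟨hx, h⟩
    rw [← coe_realVal hx]
    exact_mod_cast h

theorem le_iff_realVal_le {f : V → WithTop ℝ} {x y : V} (hy : y ∈ dom f) :
    f x ≤ f y ↔ x ∈ dom f ∧ realVal f x ≤ realVal f y := by
  rw [← coe_realVal hy, le_coe_iff]

variable [NormedAddCommGroup V]

theorem IsClosedConvex.convexOn [NormedSpace ℝ V] {f : V → WithTop ℝ} (hf : IsClosedConvex f) :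
    ConvexOn ℝ (dom f) (realVal f) := by
  have key : ∀ x ∈ dom f, ∀ y ∈ dom f, ∀ a b : ℝ, 0 ≤ a → 0 ≤ b → a + b = 1 →
      f (a • x + b • y) ≤ ((a • realVal f x + b • realVal f y : ℝ) : WithTop ℝ) := by
    intro x hx y hy a b ha hb hab
    have hx' : (x, realVal f x) ∈ epigraph f := (coe_realVal hx).ge
    have hy' : (y, realVal f y) ∈ epigraph f := (coe_realVal hy).ge
    exact hf.convex hx' hy' ha hb hab
  refine ⟨fun x hx y hy a b ha hb hab => mem_dom_of_le (key x hx y hy a b ha hb hab), ?_⟩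
  intro x hx y hy a b ha hb hab
  exact (le_coe_iff.1 (key x hx y hy a b ha hb hab)).2

theorem IsClosedConvex.isClosed_sublevel [NormedSpace ℝ V] {f : V → WithTop ℝ}
    (hf : IsClosedConvex f) (r : ℝ) : IsClosed {x | f x ≤ r} :=
  hf.closed.preimage (Continuous.prodMk_left r)

theorem IsClosedConvex.lowerSemicontinuous [NormedSpace ℝ V] {f : V → WithTop ℝ}
    (hf : IsClosedConvex f) : LowerSemicontinuous f := by
  rw [lowerSemicontinuous_iff_isClosed_preimage]
  intro y
  induction y with
  | top => simp
  | coe r => exact hf.isClosed_sublevel r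

/-- A strict lower bound of a sum splits into strict lower bounds of the summands. -/
theorem exists_coe_lt_of_lt_add {u v : WithTop ℝ} {a : WithTop ℝ} (h : a < u + v) :
    ∃ b c : ℝ, (b : WithTop ℝ) < u ∧ (c : WithTop ℝ) < v ∧ a ≤ ((b + c : ℝ) : WithTop ℝ) := by
  obtain ⟨a, rfl⟩ := WithTop.ne_top_iff_exists.1 (ne_top_of_lt h)
  have sub : ∀ {w : WithTop ℝ}, ∃ b : ℝ, (b : WithTop ℝ) < w := by
    intro w
    induction w with
    | top => exact ⟨0, WithTop.coe_lt_top _⟩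
    | coe w => exact ⟨w - 1, by exact_mod_cast sub_one_lt w⟩
  induction u with
  | top =>
    obtain ⟨c, hc⟩ := sub (w := v)
    exact ⟨a - c, c, WithTop.coe_lt_top _, hc, by simp⟩
  | coe u =>
    induction v with
    | top => exact ⟨u - 1, a - (u - 1), by exact_mod_cast sub_one_lt u, WithTop.coe_lt_top _,
        by simp⟩
    | coe v =>
      have h' : a < u + v := by exact_mod_cast h
      refine ⟨u - (u + v - a) / 2, v - (u + v - a) / 2, ?_, ?_, ?_⟩
      · exact_mod_cast (by linarith)
      · exact_mod_cast (by linarith)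
      · exact_mod_cast (by linarith)

theorem lowerSemicontinuous_add {f g : V → WithTop ℝ} (hf : LowerSemicontinuous f)
    (hg : LowerSemicontinuous g) : LowerSemicontinuous fun x => f x + g x := by
  intro x a ha
  obtain ⟨b, c, hb, hc, hle⟩ := exists_coe_lt_of_lt_add ha
  filter_upwards [hf x b hb, hg x c hc] with y hy hy'
  refine hle.trans_lt ?_
  rw [WithTop.coe_add]
  exact WithTop.add_lt_add hy hy'

theorem lowerSemicontinuous_finset_sum {ι : Type*} (s : Finset ι) {f : ι → V → WithTop ℝ}
    (hf : ∀ i, LowerSemicontinuous (f i)) : LowerSemicontinuous fun x => ∑ i ∈ s, f i x := by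
  classical
  induction s using Finset.induction_on with
  | empty => simpa using lowerSemicontinuous_const
  | insert i s hi ih =>
    simp only [Finset.sum_insert hi]
    exact lowerSemicontinuous_add (hf i) ih

/-- The subgradient inequality in real terms. -/
theorem subdiff_le [InnerProductSpace ℝ V] {g : V → WithTop ℝ} {z s y : V}
    (hs : s ∈ subdiff g z) (hy : y ∈ dom g) :
    realVal g z + inner ℝ s (y - z) ≤ realVal g y := by
  have := hs.2 y
  rw [← coe_realVal hs.1, ← coe_realVal hy] at this
  exact_mod_cast this

/-- In a finite-dimensional space, a lower semicontinuous function that is convex on its domain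
and has a unique minimizer has compact sublevel sets: on the unit sphere around the minimizer it
exceeds its minimum by some `δ > 0`, so by convexity it grows at least linearly. -/
theorem isCompact_sublevel [NormedSpace ℝ V] [FiniteDimensional ℝ V] {F : V → WithTop ℝ}
    (hlsc : LowerSemicontinuous F) (hconv : ConvexOn ℝ (dom F) (realVal F)) {z : V}
    (hz : z ∈ dom F) (hmin : ∀ y, F z ≤ F y) (huniq : ∀ w, (∀ y, F w ≤ F y) → w = z) (c : ℝ) :
    IsCompact {x | F x ≤ c} := by
  have hclosed : IsClosed {x | F x ≤ c} :=
    lowerSemicontinuous_iff_isClosed_preimage.1 hlsc (c : WithTop ℝ)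
  -- the point of the unit sphere on the segment from `z` to `y`
  have hpt : ∀ y, 1 < ‖y - z‖ → z + (1 / ‖y - z‖) • (y - z) ∈ Metric.sphere z 1 := by
    intro y hy
    have : ‖y - z‖ ≠ 0 := by positivity
    simp [norm_smul, this]
  by_cases hne : (Metric.sphere z 1).Nonempty
  · have : ProperSpace V := FiniteDimensional.proper ℝ V
    obtain ⟨w, hw, hwmin⟩ := LowerSemicontinuousOn.exists_isMinOn hne (isCompact_sphere z 1)
      (hlsc.lowerSemicontinuousOn _)
    have hlt : F z < F w := by
      refine lt_of_le_of_ne (hmin w) fun h => ?_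
      have : w = z := huniq w fun y => h ▸ hmin y
      simp [this] at hw
    obtain ⟨m, hzm, hm⟩ : ∃ m : ℝ, realVal F z < m ∧ ∀ y ∈ Metric.sphere z 1, y ∈ dom F →
        m ≤ realVal F y := by
      by_cases hwd : w ∈ dom F
      · refine ⟨realVal F w, ?_, fun y hy hyd => ?_⟩
        · rw [← coe_realVal hz, ← coe_realVal hwd] at hlt
          exact_mod_cast hlt
        · exact ((le_iff_realVal_le hyd).1 (hwmin hy)).2
      · refine ⟨realVal F z + 1, by linarith, fun y hy hyd => ?_⟩
        exact absurd (((le_iff_realVal_le hyd).1 (hwmin hy)).1) hwd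
    refine Metric.isCompact_of_isClosed_isBounded hclosed ?_
    refine (Metric.isBounded_closedBall (x := z)
      (r := max 1 ((c - realVal F z) / (m - realVal F z)))).subset fun y hy => ?_
    obtain ⟨hyd, hyc⟩ := le_coe_iff.1 hy
    rw [mem_closedBall_iff_norm]
    by_contra! hlarge
    have h1 : 1 < ‖y - z‖ := (le_max_left _ _).trans_lt hlarge
    have h2 := (le_max_right _ _).trans_lt hlarge
    have h0 : 0 < ‖y - z‖ := by linarith
    have hcomb : z + (1 / ‖y - z‖) • (y - z) = (1 - 1 / ‖y - z‖) • z + (1 / ‖y - z‖) • y := by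
      module
    have ha : 0 ≤ 1 - 1 / ‖y - z‖ := by
      rw [sub_nonneg, div_le_one h0]; exact h1.le
    have hd := hconv.1 hz hyd ha (by positivity : 0 ≤ 1 / ‖y - z‖) (by ring)
    have hle := hconv.2 hz hyd ha (by positivity : 0 ≤ 1 / ‖y - z‖) (by ring)
    rw [← hcomb] at hd hle
    have := hm _ (hpt y h1) hd
    rw [div_lt_iff₀ (by linarith)] at h2
    simp only [smul_eq_mul] at hle
    have h3 : m - realVal F z ≤ 1 / ‖y - z‖ * (realVal F y - realVal F z) := by linarith
    rw [one_div, inv_mul_eq_div, le_div_iff₀ h0] at h3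
    linarith
  · have : ProperSpace V := FiniteDimensional.proper ℝ V
    refine Metric.isCompact_of_isClosed_isBounded hclosed ?_
    refine (Metric.isBounded_closedBall (x := z) (r := 1)).subset fun y _ => ?_
    rw [mem_closedBall_iff_norm]
    by_contra! h
    exact hne ⟨_, hpt y h⟩

end Extended

/-! ### Self-concordant functions along a line -/

/-- The differential inequality of self-concordance, integrated once: if `q' ≤ 2 q ^ (3/2)` on
`[0, T]` and `q 0 ≤ r ^ 2` with `r T < 1`, then `q t ≤ (r / (1 - r t)) ^ 2`. -/
theorem le_of_deriv_le_two_mul_rpow {q q' : ℝ → ℝ} {r T : ℝ} (hr : 0 ≤ r) (hrT : r * T < 1)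
    (hq : ∀ t ∈ Set.Icc 0 T, HasDerivAt q (q' t) t)
    (hq' : ∀ t ∈ Set.Icc 0 T, q' t ≤ 2 * q t ^ (3 / 2 : ℝ)) (h0 : q 0 ≤ r ^ 2)
    {t : ℝ} (ht : t ∈ Set.Icc 0 T) : q t ≤ (r / (1 - r * t)) ^ 2 := by
  have hT : 0 ≤ T := ht.1.trans ht.2
  -- The strict supersolutions `(a / (1 - b t)) ^ 2` with `r < a < b` converge to the bound.
  have key : ∀ᶠ ε in 𝓝[>] (0 : ℝ), q t ≤ ((r + ε) / (1 - (r + 2 * ε) * t)) ^ 2 := by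
    have hsmall : ∀ᶠ ε in 𝓝[>] (0 : ℝ), (r + 2 * ε) * T < 1 := by
      refine Filter.Eventually.filter_mono nhdsWithin_le_nhds ?_
      have : ContinuousAt (fun ε : ℝ => (r + 2 * ε) * T) 0 := by fun_prop
      exact this.eventually_lt continuousAt_const (by simpa using hrT)
    filter_upwards [hsmall, self_mem_nhdsWithin] with ε hε hε0
    have hε0 : 0 < ε := hε0
    have hpos : ∀ s ∈ Set.Icc 0 T, 0 < 1 - (r + 2 * ε) * s := by
      intro s hs
      have : (r + 2 * ε) * s ≤ (r + 2 * ε) * T := by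
        apply mul_le_mul_of_nonneg_left hs.2; positivity
      linarith
    have hB : ∀ s ∈ Set.Icc 0 T, HasDerivAt
        (fun s => ((r + ε) / (1 - (r + 2 * ε) * s)) ^ 2)
        (2 * (r + ε) ^ 2 * (r + 2 * ε) / (1 - (r + 2 * ε) * s) ^ 3) s := by
      intro s hs
      have hne := (hpos s hs).ne'
      have h1 : HasDerivAt (fun s : ℝ => 1 - (r + 2 * ε) * s) (-(r + 2 * ε)) s := by
        simpa using ((hasDerivAt_id s).const_mul (r + 2 * ε)).const_sub 1
      have h2 := (((hasDerivAt_const s (r + ε)).div h1 hne).pow 2)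
      refine h2.congr_deriv ?_
      simp only [Pi.div_apply]
      generalize 1 - (r + 2 * ε) * s = D at hne
      simp only [Nat.cast_ofNat, Nat.add_one_sub_one, pow_one, zero_mul, zero_sub]
      field_simp
    refine image_le_of_deriv_right_lt_deriv_boundary' (a := 0) (b := T) (f' := q')
      (B' := fun s => 2 * (r + ε) ^ 2 * (r + 2 * ε) / (1 - (r + 2 * ε) * s) ^ 3)
      (fun s hs => (hq s hs).continuousAt.continuousWithinAt)
      (fun s hs => (hq s ⟨hs.1, hs.2.le⟩).hasDerivWithinAt) ?_
      (fun s hs => (hB s hs).continuousAt.continuousWithinAt)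
      (fun s hs => (hB s ⟨hs.1, hs.2.le⟩).hasDerivWithinAt) ?_ ht
    · simp only [mul_zero, sub_zero, div_one]
      nlinarith
    · intro s hs heq
      have hs' : s ∈ Set.Icc 0 T := ⟨hs.1, hs.2.le⟩
      have hp := hpos s hs'
      refine (hq' s hs').trans_lt ?_
      have hnn : 0 ≤ (r + ε) / (1 - (r + 2 * ε) * s) := by positivity
      have : (((r + ε) / (1 - (r + 2 * ε) * s)) ^ 2) ^ (3 / 2 : ℝ)
          = ((r + ε) / (1 - (r + 2 * ε) * s)) ^ 3 := by
        rw [← Real.rpow_natCast _ 2, ← Real.rpow_mul hnn, ← Real.rpow_natCast _ 3]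
        norm_num
      rw [heq, this, div_pow, ← mul_div_assoc]
      apply div_lt_div_of_pos_right _ (by positivity)
      have : 0 < (r + ε) ^ 2 := by positivity
      nlinarith
  have hlim : Tendsto (fun ε : ℝ => ((r + ε) / (1 - (r + 2 * ε) * t)) ^ 2) (𝓝[>] 0)
      (𝓝 ((r / (1 - r * t)) ^ 2)) := by
    have hne : 1 - r * t ≠ 0 := by
      have : r * t ≤ r * T := mul_le_mul_of_nonneg_left ht.2 hr
      linarith
    have : ContinuousAt (fun ε : ℝ => ((r + ε) / (1 - (r + 2 * ε) * t)) ^ 2) 0 := by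
      refine ContinuousAt.pow (ContinuousAt.div (by fun_prop) (by fun_prop) ?_) 2
      simpa using hne
    have h := this.tendsto
    simp only [add_zero, mul_zero] at h
    exact h.mono_left nhdsWithin_le_nhds
  exact ge_of_tendsto hlim key

/-- The same differential inequality integrated three times, for `q = ψ''`. -/
theorem le_add_of_second_deriv_le {ψ ψ' ψ'' ψ''' : ℝ → ℝ} {r T : ℝ} (hr : 0 ≤ r)
    (hrT : r * T < 1)
    (h1 : ∀ t ∈ Set.Icc 0 T, HasDerivAt ψ (ψ' t) t)
    (h2 : ∀ t ∈ Set.Icc 0 T, HasDerivAt ψ' (ψ'' t) t)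
    (h3 : ∀ t ∈ Set.Icc 0 T, HasDerivAt ψ'' (ψ''' t) t)
    (hψ : ∀ t ∈ Set.Icc 0 T, ψ''' t ≤ 2 * ψ'' t ^ (3 / 2 : ℝ)) (h0 : ψ'' 0 ≤ r ^ 2)
    {t : ℝ} (ht : t ∈ Set.Icc 0 T) :
    ψ t ≤ ψ 0 + t * ψ' 0 + (-(r * t) - Real.log (1 - r * t)) := by
  have hpos : ∀ s ∈ Set.Icc 0 T, 0 < 1 - r * s := by
    intro s hs
    have : r * s ≤ r * T := mul_le_mul_of_nonneg_left hs.2 hr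
    linarith
  have hlin : ∀ s, HasDerivAt (fun s : ℝ => 1 - r * s) (-r) s := by
    intro s
    simpa using ((hasDerivAt_id s).const_mul r).const_sub 1
  have d1 : ∀ s ∈ Set.Icc 0 T, ψ' s ≤ ψ' 0 + (-r + r / (1 - r * s)) := by
    intro s hs
    have hB : ∀ x ∈ Set.Icc 0 T, HasDerivAt (fun s => ψ' 0 + (-r + r / (1 - r * s)))
        ((r / (1 - r * x)) ^ 2) x := by
      intro x hx
      have hne := (hpos x hx).ne'
      have := (((hasDerivAt_const x r).div (hlin x) hne).const_add (-r)).const_add (ψ' 0)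
      refine this.congr_deriv ?_
      field_simp
      ring
    refine image_le_of_deriv_right_le_deriv_boundary (a := 0) (b := T) (f' := ψ'')
      (B' := fun x => (r / (1 - r * x)) ^ 2)
      (fun s hs => (h2 s hs).continuousAt.continuousWithinAt)
      (fun s hs => (h2 s ⟨hs.1, hs.2.le⟩).hasDerivWithinAt) (by simp)
      (fun s hs => (hB s hs).continuousAt.continuousWithinAt)
      (fun s hs => (hB s ⟨hs.1, hs.2.le⟩).hasDerivWithinAt) ?_ hs
    intro x hx
    exact le_of_deriv_le_two_mul_rpow hr hrT h3 hψ h0 ⟨hx.1, hx.2.le⟩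
  have hB : ∀ x ∈ Set.Icc 0 T, HasDerivAt
      (fun t => ψ 0 + t * ψ' 0 + (-(r * t) - Real.log (1 - r * t)))
      (ψ' 0 + (-r + r / (1 - r * x))) x := by
    intro x hx
    have hne := (hpos x hx).ne'
    have e1 : HasDerivAt (fun t : ℝ => ψ 0 + t * ψ' 0) (ψ' 0) x := by
      simpa using ((hasDerivAt_id x).mul_const (ψ' 0)).const_add (ψ 0)
    have e2 : HasDerivAt (fun t : ℝ => -(r * t)) (-r) x := by
      simpa using ((hasDerivAt_id' x).const_mul r).fun_neg
    have := e1.add (e2.sub ((hlin x).log hne))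
    refine this.congr_deriv ?_
    field_simp
    ring
  refine image_le_of_deriv_right_le_deriv_boundary (a := 0) (b := T) (f' := ψ')
    (B' := fun x => ψ' 0 + (-r + r / (1 - r * x)))
    (fun s hs => (h1 s hs).continuousAt.continuousWithinAt)
    (fun s hs => (h1 s ⟨hs.1, hs.2.le⟩).hasDerivWithinAt) (by simp)
    (fun s hs => (hB s hs).continuousAt.continuousWithinAt)
    (fun s hs => (hB s ⟨hs.1, hs.2.le⟩).hasDerivWithinAt) ?_ ht
  intro x hx
  exact d1 x ⟨hx.1, hx.2.le⟩

section Line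

variable {V : Type*} [NormedAddCommGroup V] [NormedSpace ℝ V] {f : V → WithTop ℝ}

/-- The parameters at which the line through `x` with direction `u` meets `dom f`. -/
def lineDom (f : V → WithTop ℝ) (x u : V) : Set ℝ := {t | x + t • u ∈ dom f}

theorem isOpen_lineDom {M : ℝ} (hf : IsSelfConcordant M f) (x u : V) : IsOpen (lineDom f x u) :=
  hf.isOpen_dom.preimage (by fun_prop)

/-- The derivatives of `ψ t = f (x + t u)` up to order three, and the inequality of
self-concordance at every parameter of the line. -/
theorem line_derivs {M : ℝ} (hf : IsSelfConcordant M f) (x u : V) {t : ℝ}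
    (ht : t ∈ lineDom f x u) :
    let ψ := fun s : ℝ => realVal f (x + s • u)
    (∀ k < 3, HasDerivAt (iteratedDeriv k ψ) (iteratedDeriv (k + 1) ψ t) t) ∧
      |iteratedDeriv 3 ψ t| ≤ M * (iteratedDeriv 2 ψ t) ^ (3 / 2 : ℝ) := by
  intro ψ
  have hC : ContDiffAt ℝ 3 ψ t := by
    have h := hf.contDiffOn.contDiffAt (hf.isOpen_dom.mem_nhds (show x + t • u ∈ dom f from ht))
    exact ContDiffAt.comp (g := realVal f) t h (by fun_prop)
  constructor
  · intro k hk
    rw [iteratedDeriv_succ]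
    refine DifferentiableAt.hasDerivAt ?_
    have h : ContDiffAt ℝ 1 (iteratedFDeriv ℝ k ψ) t :=
      hC.iteratedFDeriv_right (by exact_mod_cast (by omega : 1 + k ≤ 3))
    exact (h.differentiableAt one_ne_zero).continuousMultilinear_apply_const _
  · have h := hf.third_deriv_le (x + t • u) ht u
    have e : (fun s : ℝ => realVal f (x + t • u + s • u)) = fun s => ψ (t + s) := by
      funext s
      simp only [ψ]
      congr 1
      module
    rw [e, iteratedDeriv_comp_const_add, iteratedDeriv_comp_const_add] at h
    simpa using h

/-- The Dikin segment: if `ψ''(0) ≤ r ^ 2` for `ψ t = f (x + t u)` and `r < 1`, then `x + u` lies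
in the domain and `f (x + u) ≤ f x + ψ'(0) - r - log (1 - r)`. The upper bound stays finite along
the segment, and `f` is closed with an open domain, so the segment cannot leave the domain. -/
theorem dikin {r : ℝ} (hf : IsStandardSelfConcordant f) {x u : V} (hx : x ∈ dom f)
    (hr : 0 ≤ r) (hr1 : r < 1)
    (h0 : iteratedDeriv 2 (fun t : ℝ => realVal f (x + t • u)) 0 ≤ r ^ 2) :
    x + u ∈ dom f ∧ realVal f (x + u) ≤ realVal f x
      + deriv (fun t : ℝ => realVal f (x + t • u)) 0 + (-r - Real.log (1 - r)) := by
  set ψ := fun t : ℝ => realVal f (x + t • u) with hψ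
  have hf' : IsSelfConcordant 2 f := hf
  have h0mem : (0 : ℝ) ∈ lineDom f x u := by simpa [lineDom] using hx
  have hconv : Convex ℝ (lineDom f x u) := by
    have : lineDom f x u = (AffineMap.lineMap x (x + u) : ℝ →ᵃ[ℝ] V) ⁻¹' dom f := by
      ext t
      simp [lineDom, AffineMap.lineMap_apply, add_comm]
    rw [this]
    exact hf'.toIsClosedConvex.convexOn.1.affine_preimage _
  have hbound : ∀ T, 0 ≤ T → T ≤ 1 → T ∈ lineDom f x u →
      ψ T ≤ ψ 0 + T * deriv ψ 0 + (-(r * T) - Real.log (1 - r * T)) := by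
    intro T hT0 hT1 hT
    have hsub : ∀ t ∈ Set.Icc 0 T, t ∈ lineDom f x u := fun t ht =>
      hconv.ordConnected.out h0mem hT ht
    refine le_add_of_second_deriv_le (ψ' := deriv ψ) (ψ'' := iteratedDeriv 2 ψ)
      (ψ''' := iteratedDeriv 3 ψ) hr (T := T) ?_ ?_ ?_ ?_ ?_ h0 ⟨hT0, le_rfl⟩
    · nlinarith
    · intro t ht
      simpa using (line_derivs hf' x u (hsub t ht)).1 0 (by norm_num)
    · intro t ht
      simpa using (line_derivs hf' x u (hsub t ht)).1 1 (by norm_num)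
    · intro t ht
      exact (line_derivs hf' x u (hsub t ht)).1 2 (by norm_num)
    · intro t ht
      exact (le_abs_self _).trans (line_derivs hf' x u (hsub t ht)).2
  have hψ0 : ψ 0 = realVal f x := by simp [hψ]
  -- a bound that is uniform along the segment
  obtain ⟨K, hK⟩ : ∃ K, ∀ T, 0 ≤ T → T ≤ 1 → T ∈ lineDom f x u → ψ T ≤ K := by
    refine ⟨ψ 0 + |deriv ψ 0| + -Real.log (1 - r), fun T hT0 hT1 hT => ?_⟩
    refine (hbound T hT0 hT1 hT).trans ?_
    have e1 : T * deriv ψ 0 ≤ |deriv ψ 0| := by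
      calc T * deriv ψ 0 ≤ T * |deriv ψ 0| := mul_le_mul_of_nonneg_left (le_abs_self _) hT0
        _ ≤ |deriv ψ 0| := mul_le_of_le_one_left (abs_nonneg _) hT1
    have e2 : Real.log (1 - r) ≤ Real.log (1 - r * T) := by
      apply Real.log_le_log <;> nlinarith
    have e3 : 0 ≤ r * T := by positivity
    linarith
  have hall : Set.Icc (0 : ℝ) 1 ⊆ lineDom f x u := by
    refine IsClosed.Icc_subset_of_forall_exists_gt ?_ h0mem ?_
    · have : lineDom f x u ∩ Set.Icc 0 1 = {t : ℝ | f (x + t • u) ≤ K} ∩ Set.Icc 0 1 := by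
        ext t
        constructor
        · rintro ⟨ht, ht'⟩
          exact ⟨le_coe_iff.2 ⟨ht, hK t ht'.1 ht'.2 ht⟩, ht'⟩
        · rintro ⟨ht, ht'⟩
          exact ⟨mem_dom_of_le ht, ht'⟩
      rw [this]
      refine IsClosed.inter ?_ isClosed_Icc
      exact (hf'.toIsClosedConvex.isClosed_sublevel K).preimage
        (f := fun t : ℝ => x + t • u) (by fun_prop)
    · rintro t ⟨ht, -⟩ y hy
      have hnhds := (isOpen_lineDom hf' x u).mem_nhds ht
      have : ∀ᶠ s in 𝓝[>] t, s ∈ lineDom f x u ∧ s ∈ Set.Ioc t y :=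
        (Filter.Eventually.filter_mono nhdsWithin_le_nhds hnhds).and (Ioc_mem_nhdsGT hy)
      obtain ⟨s, hs⟩ := this.exists
      exact ⟨s, hs⟩
  have h1 : (1 : ℝ) ∈ lineDom f x u := hall ⟨zero_le_one, le_rfl⟩
  refine ⟨by simpa [lineDom] using h1, ?_⟩
  have := hbound 1 zero_le_one le_rfl h1
  rw [hψ0] at this
  simpa [hψ] using this

end Line

variable {n : ℕ} {N : Fin n → ℕ}

/-! ### Blocks, the objective and its domain -/

theorem embed_apply_self (i : Fin n) (y : Block N i) : (embed i y : BlockVec N) i = y := by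
  simp [embed]

theorem embed_apply_ne {i j : Fin n} (h : j ≠ i) (y : Block N i) :
    (embed i y : BlockVec N) j = 0 := by
  simp [embed, h]

theorem inner_embed_left (i : Fin n) (y : Block N i) (z : BlockVec N) :
    inner ℝ (embed i y) z = inner ℝ y (z i) := by
  rw [PiLp.inner_apply, Finset.sum_eq_single i]
  · rw [embed_apply_self]
  · intro j _ hj
    rw [embed_apply_ne hj, inner_zero_left]
  · simp

theorem norm_embed (i : Fin n) (y : Block N i) : ‖(embed i y : BlockVec N)‖ = ‖y‖ := by
  rw [@norm_eq_sqrt_real_inner _ _ _ (embed i y), inner_embed_left, embed_apply_self,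
    ← norm_eq_sqrt_real_inner]

theorem embed_smul (i : Fin n) (c : ℝ) (y : Block N i) :
    (embed i (c • y) : BlockVec N) = c • embed i y := by
  simp [embed, Pi.single_smul]

theorem embed_ne_zero {i : Fin n} {y : Block N i} (hy : y ≠ 0) : (embed i y : BlockVec N) ≠ 0 := by
  rw [← norm_ne_zero_iff, norm_embed]
  exact norm_ne_zero_iff.2 hy

theorem blockStep_eq_add (f : BlockVec N → WithTop ℝ) (x : BlockVec N) (i : Fin n)
    (d : Block N i) : blockStep f x i d = x + embed i ((1 / (1 + blockNorm f x i d)) • d) := by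
  ext1 j
  by_cases h : j = i
  · subst h
    simp [blockStep, embed]
  · simp [blockStep, embed, h]

theorem add_embed_apply_self (x : BlockVec N) (i : Fin n) (y : Block N i) :
    (x + embed i y) i = x i + y := by
  rw [PiLp.add_apply, embed_apply_self]

theorem add_embed_apply_ne (x : BlockVec N) {i j : Fin n} (h : j ≠ i) (y : Block N i) :
    (x + embed i y) j = x j := by
  rw [PiLp.add_apply, embed_apply_ne h, add_zero]

variable {f : BlockVec N → WithTop ℝ} {g : ∀ i, Block N i → WithTop ℝ}

theorem mem_dom_separable {x : BlockVec N} : x ∈ dom (separable g) ↔ ∀ i, x i ∈ dom (g i) := by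
  simp [dom, separable, WithTop.sum_eq_top]

theorem mem_dom_objective {x : BlockVec N} :
    x ∈ dom (objective f g) ↔ x ∈ dom f ∧ ∀ i, x i ∈ dom (g i) := by
  rw [← mem_dom_separable]
  simp [dom, objective]

theorem realVal_separable {x : BlockVec N} (hx : ∀ i, x i ∈ dom (g i)) :
    realVal (separable g) x = ∑ i, realVal (g i) (x i) := by
  have : separable g x = ((∑ i, realVal (g i) (x i) : ℝ) : WithTop ℝ) := by
    rw [WithTop.coe_sum]
    exact Finset.sum_congr rfl fun i _ => (coe_realVal (hx i)).symm
  rw [realVal, this, WithTop.untopD_coe]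

theorem realVal_objective {x : BlockVec N} (hx : x ∈ dom (objective f g)) :
    realVal (objective f g) x = realVal f x + realVal (separable g) x := by
  obtain ⟨h1, h2⟩ := mem_dom_objective.1 hx
  have : objective f g x = ((realVal f x + realVal (separable g) x : ℝ) : WithTop ℝ) := by
    rw [WithTop.coe_add, coe_realVal h1, coe_realVal (mem_dom_separable.2 h2)]
    rfl
  rw [realVal, this, WithTop.untopD_coe]

/-- A change in one block changes `g` by the change of the corresponding `g_i`. -/
theorem realVal_separable_add_embed {x : BlockVec N} (hx : ∀ i, x i ∈ dom (g i)) (i : Fin n)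
    {y : Block N i} (hy : x i + y ∈ dom (g i)) :
    (∀ j, (x + embed i y) j ∈ dom (g j)) ∧ realVal (separable g) (x + embed i y)
      = realVal (separable g) x + (realVal (g i) (x i + y) - realVal (g i) (x i)) := by
  have hdom : ∀ j, (x + embed i y) j ∈ dom (g j) := by
    intro j
    by_cases h : j = i
    · subst h
      rwa [add_embed_apply_self]
    · rw [add_embed_apply_ne x h]
      exact hx j
  refine ⟨hdom, ?_⟩
  rw [realVal_separable hdom, realVal_separable hx, ← sub_eq_iff_eq_add', ← Finset.sum_sub_distrib,
    Finset.sum_eq_single i]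
  · rw [add_embed_apply_self]
  · intro j _ hj
    rw [add_embed_apply_ne x hj, sub_self]
  · simp

theorem lowerSemicontinuous_objective (hf : IsClosedConvex f) (hg : ∀ i, IsClosedConvex (g i)) :
    LowerSemicontinuous (objective f g) := by
  refine lowerSemicontinuous_add hf.lowerSemicontinuous ?_
  refine lowerSemicontinuous_finset_sum _ (f := fun i (x : BlockVec N) => g i (x i)) fun i => ?_
  exact (hg i).lowerSemicontinuous.comp (by fun_prop : Continuous fun x : BlockVec N => x i)

theorem convexOn_objective (hf : IsClosedConvex f) (hg : ∀ i, IsClosedConvex (g i)) :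
    ConvexOn ℝ (dom (objective f g)) (realVal (objective f g)) := by
  have hconv : Convex ℝ (dom (objective f g)) := by
    intro x hx y hy a b ha hb hab
    obtain ⟨hx1, hx2⟩ := mem_dom_objective.1 hx
    obtain ⟨hy1, hy2⟩ := mem_dom_objective.1 hy
    exact mem_dom_objective.2 ⟨hf.convexOn.1 hx1 hy1 ha hb hab,
      fun i => (hg i).convexOn.1 (hx2 i) (hy2 i) ha hb hab⟩
  refine ⟨hconv, ?_⟩
  intro x hx y hy a b ha hb hab
  have hz := hconv hx hy ha hb hab
  obtain ⟨hx1, hx2⟩ := mem_dom_objective.1 hx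
  obtain ⟨hy1, hy2⟩ := mem_dom_objective.1 hy
  rw [realVal_objective hz, realVal_objective hx, realVal_objective hy,
    realVal_separable (mem_dom_objective.1 hz).2, realVal_separable hx2, realVal_separable hy2]
  have e1 := hf.convexOn.2 hx1 hy1 ha hb hab
  have e2 : ∑ i, realVal (g i) ((a • x + b • y) i)
      ≤ ∑ i, (a * realVal (g i) (x i) + b * realVal (g i) (y i)) :=
    Finset.sum_le_sum fun i _ => (hg i).convexOn.2 (hx2 i) (hy2 i) ha hb hab
  rw [Finset.sum_add_distrib, ← Finset.mul_sum, ← Finset.mul_sum] at e2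
  simp only [smul_eq_mul] at e1 ⊢
  linarith

/-! ### The gradient and the Hessian -/

theorem inner_grad (f : BlockVec N → WithTop ℝ) (x u : BlockVec N) :
    inner ℝ (grad f x) u = fderiv ℝ (realVal f) x u := by
  rw [grad, gradient, InnerProductSpace.toDual_symm_apply]

theorem contDiffOn_grad {M : ℝ} (hf : IsSelfConcordant M f) :
    ContDiffOn ℝ 2 (grad f) (dom f) := by
  let J : (BlockVec N →L[ℝ] ℝ) →L[ℝ] BlockVec N := LinearMap.toContinuousLinearMap
    { toFun := fun l => (InnerProductSpace.toDual ℝ (BlockVec N)).symm l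
      map_add' := fun a b => map_add _ a b
      map_smul' := fun c a => by
        rw [LinearIsometryEquiv.map_smulₛₗ]
        simp }
  exact J.contDiff.comp_contDiffOn
    (hf.contDiffOn.fderiv_of_isOpen hf.isOpen_dom (by norm_num))

theorem continuousOn_hess {M : ℝ} (hf : IsSelfConcordant M f) :
    ContinuousOn (hess f) (dom f) :=
  (contDiffOn_grad hf).continuousOn_fderiv_of_isOpen hf.isOpen_dom (by norm_num)

theorem hasFDerivAt_grad {M : ℝ} (hf : IsSelfConcordant M f) {x : BlockVec N} (hx : x ∈ dom f) :
    HasFDerivAt (grad f) (hess f x) x :=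
  (((contDiffOn_grad hf).contDiffAt (hf.isOpen_dom.mem_nhds hx)).differentiableAt
    (by norm_num)).hasFDerivAt

theorem hasFDerivAt_realVal {M : ℝ} (hf : IsSelfConcordant M f) {x : BlockVec N}
    (hx : x ∈ dom f) : HasFDerivAt (realVal f) (fderiv ℝ (realVal f) x) x :=
  ((hf.contDiffOn.contDiffAt (hf.isOpen_dom.mem_nhds hx)).differentiableAt
    (by norm_num)).hasFDerivAt

theorem inner_hess {M : ℝ} (hf : IsSelfConcordant M f) {x : BlockVec N} (hx : x ∈ dom f)
    (u w : BlockVec N) :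
    inner ℝ (hess f x w) u = fderiv ℝ (fderiv ℝ (realVal f)) x w u := by
  have h1 : HasFDerivAt (fun y => inner ℝ (grad f y) u)
      ((innerSL ℝ u).comp (hess f x)) x := by
    have := ((innerSL ℝ u).hasFDerivAt (x := grad f x)).comp x (hasFDerivAt_grad hf hx)
    refine this.congr_of_eventuallyEq (Eventually.of_forall fun y => ?_)
    exact real_inner_comm _ _
  have hC := hf.contDiffOn.contDiffAt (hf.isOpen_dom.mem_nhds hx)
  have h2 : HasFDerivAt (fun y => fderiv ℝ (realVal f) y u)
      ((fderiv ℝ (fderiv ℝ (realVal f)) x).flip u) x := by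
    have h : HasFDerivAt (fderiv ℝ (realVal f)) (fderiv ℝ (fderiv ℝ (realVal f)) x) x :=
      ((hC.fderiv_right (m := 1) (by norm_num)).differentiableAt one_ne_zero).hasFDerivAt
    simpa using h.clm_apply (hasFDerivAt_const u x)
  simp only [inner_grad] at h1
  have := congrArg (fun L => L w) (h1.unique h2)
  simpa [real_inner_comm] using this

theorem hess_symm {M : ℝ} (hf : IsSelfConcordant M f) {x : BlockVec N} (hx : x ∈ dom f)
    (u w : BlockVec N) : inner ℝ u (hess f x w) = inner ℝ w (hess f x u) := by
  have hC := hf.contDiffOn.contDiffAt (hf.isOpen_dom.mem_nhds hx)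
  have hs : IsSymmSndFDerivAt ℝ (realVal f) x := hC.isSymmSndFDerivAt (by simp; norm_num)
  rw [real_inner_comm, real_inner_comm _ w, inner_hess hf hx, inner_hess hf hx]
  exact hs w u

theorem hasDerivAt_line {M : ℝ} (hf : IsSelfConcordant M f) (x u : BlockVec N) {t : ℝ}
    (ht : t ∈ lineDom f x u) :
    HasDerivAt (fun t : ℝ => realVal f (x + t • u)) (inner ℝ (grad f (x + t • u)) u) t := by
  have hl : HasDerivAt (fun t : ℝ => x + t • u) u t := by
    simpa using ((hasDerivAt_id t).smul_const u).const_add x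
  rw [inner_grad]
  exact (hasFDerivAt_realVal hf ht).comp_hasDerivAt t hl

theorem iteratedDeriv_two_line {M : ℝ} (hf : IsSelfConcordant M f) {x : BlockVec N}
    (hx : x ∈ dom f) (u : BlockVec N) :
    iteratedDeriv 2 (fun t : ℝ => realVal f (x + t • u)) 0 = inner ℝ u (hess f x u) := by
  have h0 : (0 : ℝ) ∈ lineDom f x u := by simpa [lineDom] using hx
  rw [iteratedDeriv_succ, iteratedDeriv_one]
  have heq : deriv (fun t : ℝ => realVal f (x + t • u))
      =ᶠ[𝓝 0] fun t => inner ℝ u (grad f (x + t • u)) := by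
    filter_upwards [(isOpen_lineDom hf x u).mem_nhds h0] with t ht
    rw [(hasDerivAt_line hf x u ht).deriv, real_inner_comm]
  rw [heq.deriv_eq]
  have hl : HasDerivAt (fun t : ℝ => x + t • u) u 0 := by
    simpa using ((hasDerivAt_id (0 : ℝ)).smul_const u).const_add x
  have hg : HasFDerivAt (grad f) (hess f x) (x + (0 : ℝ) • u) := by
    simpa using hasFDerivAt_grad hf hx
  exact ((innerSL ℝ u).hasFDerivAt.comp_hasDerivAt (0 : ℝ) (hg.comp_hasDerivAt 0 hl)).deriv

/-- The gradient inequality of a convex function. -/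
theorem realVal_add_inner_grad_le {M : ℝ} (hf : IsSelfConcordant M f) {x y : BlockVec N}
    (hx : x ∈ dom f) (hy : y ∈ dom f) :
    realVal f x + inner ℝ (grad f x) (y - x) ≤ realVal f y := by
  have h0 : (0 : ℝ) ∈ lineDom f x (y - x) := by simpa [lineDom] using hx
  have hd := hasDerivAt_line hf x (y - x) h0
  have heq : (fun t : ℝ => realVal f (x + t • (y - x)))
      = realVal f ∘ (AffineMap.lineMap x y : ℝ →ᵃ[ℝ] BlockVec N) := by
    funext t
    simp [AffineMap.lineMap_apply, add_comm]
  have hc := hf.toIsClosedConvex.convexOn.comp_affineMap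
    (AffineMap.lineMap x y : ℝ →ᵃ[ℝ] BlockVec N)
  rw [← heq] at hc
  have := hc.le_slope_of_hasDerivAt (x := 0) (y := 1) (by simpa using hx) (by simpa using hy)
    one_pos hd
  simp [slope] at this
  linarith

/-! ### The diagonal blocks of the Hessian -/

theorem inner_blockHess (f : BlockVec N → WithTop ℝ) (x : BlockVec N) (i : Fin n)
    (y z : Block N i) :
    inner ℝ y (blockHess f x i z) = inner ℝ (embed i y) (hess f x (embed i z)) := by
  rw [inner_embed_left]
  rfl

theorem blockHess_symm {M : ℝ} (hf : IsSelfConcordant M f) {x : BlockVec N} (hx : x ∈ dom f)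
    (i : Fin n) (y z : Block N i) :
    inner ℝ y (blockHess f x i z) = inner ℝ z (blockHess f x i y) := by
  rw [inner_blockHess, inner_blockHess, hess_symm hf hx]

theorem blockHess_nonneg {x : BlockVec N}
    (hpos : ∀ u : BlockVec N, u ≠ 0 → 0 < inner ℝ u (hess f x u)) (i : Fin n)
    (y : Block N i) : 0 ≤ inner ℝ y (blockHess f x i y) := by
  rw [inner_blockHess]
  by_cases h : (embed i y : BlockVec N) = 0
  · simp [h]
  · exact (hpos _ h).le

theorem sq_blockNorm {x : BlockVec N}
    (hpos : ∀ u : BlockVec N, u ≠ 0 → 0 < inner ℝ u (hess f x u)) (i : Fin n) (y : Block N i) :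
    blockNorm f x i y ^ 2 = inner ℝ y (blockHess f x i y) :=
  Real.sq_sqrt (blockHess_nonneg hpos i y)

theorem blockHess_comp_inverse {x : BlockVec N}
    (hpos : ∀ u : BlockVec N, u ≠ 0 → 0 < inner ℝ u (hess f x u)) (i : Fin n) (v : Block N i) :
    blockHess f x i ((blockHess f x i).inverse v) = v := by
  have hinj : Function.Injective (blockHess f x i) := by
    rw [injective_iff_map_eq_zero]
    intro y hy
    by_contra hne
    have := hpos _ (embed_ne_zero hne)
    rw [← inner_blockHess, hy, inner_zero_right] at this
    exact lt_irrefl _ this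
  let e := (LinearEquiv.ofInjectiveEndo (blockHess f x i).toLinearMap hinj).toContinuousLinearEquiv
  have he : blockHess f x i = (e : Block N i →L[ℝ] Block N i) := by
    ext1 y
    rfl
  rw [he, ContinuousLinearMap.inverse_equiv]
  simp

/-- Cauchy–Schwarz for the local inner product of a block. -/
theorem abs_inner_blockHess_le {M : ℝ} (hf : IsSelfConcordant M f) {x : BlockVec N}
    (hx : x ∈ dom f) (hpos : ∀ u : BlockVec N, u ≠ 0 → 0 < inner ℝ u (hess f x u))
    (i : Fin n) (y z : Block N i) :
    |inner ℝ y (blockHess f x i z)| ≤ blockNorm f x i y * blockNorm f x i z := by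
  let B : LinearMap.BilinForm ℝ (Block N i) :=
    (innerₗ (Block N i)).compl₂ (blockHess f x i).toLinearMap
  have hB : ∀ y z, B y z = inner ℝ y (blockHess f x i z) := fun y z => rfl
  have h := B.apply_mul_apply_le_of_forall_zero_le
    (fun y => by rw [hB]; exact blockHess_nonneg hpos i y) y z
  rw [hB, hB, hB, hB, blockHess_symm hf hx i z y, ← sq_blockNorm hpos, ← sq_blockNorm hpos,
    ← mul_pow, ← pow_two] at h
  exact abs_le_of_sq_le_sq h (mul_nonneg (Real.sqrt_nonneg _) (Real.sqrt_nonneg _))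

/-- The local norm and the dual local norm of a block are dual to each other. -/
theorem abs_inner_le_blockDualNorm_mul {M : ℝ} (hf : IsSelfConcordant M f) {x : BlockVec N}
    (hx : x ∈ dom f) (hpos : ∀ u : BlockVec N, u ≠ 0 → 0 < inner ℝ u (hess f x u))
    (i : Fin n) (v z : Block N i) :
    |inner ℝ v z| ≤ blockDualNorm f x i v * blockNorm f x i z := by
  have hw := blockHess_comp_inverse hpos i v
  set w := (blockHess f x i).inverse v with hwdef
  have e1 : blockDualNorm f x i v = blockNorm f x i w := by
    rw [blockDualNorm, blockNorm, ← hwdef, hw, real_inner_comm]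
  have e2 : inner ℝ v z = inner ℝ w (blockHess f x i z) := by
    rw [blockHess_symm hf hx, hw, real_inner_comm]
  rw [e1, e2]
  exact abs_inner_blockHess_le hf hx hpos i w z

/-! ### One step of the method -/

theorem blockNorm_nonneg (f : BlockVec N → WithTop ℝ) (x : BlockVec N) (i : Fin n)
    (y : Block N i) : 0 ≤ blockNorm f x i y :=
  Real.sqrt_nonneg _

/-- `ω(t) = t - log (1 + t)` is at least `t ^ 2 / (2 (1 + t))`. -/
theorem log_one_add_le {t : ℝ} (ht : 0 ≤ t) :
    Real.log (1 + t) ≤ t - t ^ 2 / (2 * (1 + t)) := by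
  have hB : ∀ s ∈ Set.Icc 0 t, HasDerivAt (fun s : ℝ => s - s ^ 2 / (2 * (1 + s)))
      (1 - (2 * s * (2 * (1 + s)) - s ^ 2 * 2) / (2 * (1 + s)) ^ 2) s := by
    intro s hs
    have hne : 2 * (1 + s) ≠ 0 := by have := hs.1; positivity
    have h1 : HasDerivAt (fun s : ℝ => 2 * (1 + s)) 2 s := by
      simpa using ((hasDerivAt_id s).const_add 1).const_mul 2
    have h2 : HasDerivAt (fun s : ℝ => s ^ 2) (2 * s) s := by
      simpa using hasDerivAt_pow 2 s
    exact (hasDerivAt_id s).sub (h2.div h1 hne)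
  have hA : ∀ s ∈ Set.Icc 0 t, HasDerivAt (fun s : ℝ => Real.log (1 + s)) (1 / (1 + s)) s := by
    intro s hs
    have hne : 1 + s ≠ 0 := by have := hs.1; positivity
    exact ((hasDerivAt_id s).const_add 1).log hne
  refine image_le_of_deriv_right_le_deriv_boundary (a := 0) (b := t)
    (f' := fun s => 1 / (1 + s))
    (B' := fun s => 1 - (2 * s * (2 * (1 + s)) - s ^ 2 * 2) / (2 * (1 + s)) ^ 2)
    (fun s hs => (hA s hs).continuousAt.continuousWithinAt)
    (fun s hs => (hA s ⟨hs.1, hs.2.le⟩).hasDerivWithinAt) (by simp)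
    (fun s hs => (hB s hs).continuousAt.continuousWithinAt)
    (fun s hs => (hB s ⟨hs.1, hs.2.le⟩).hasDerivWithinAt) ?_ ⟨ht, le_rfl⟩
  intro s hs
  have h0 : 0 ≤ s := hs.1
  have e : 1 - (2 * s * (2 * (1 + s)) - s ^ 2 * 2) / (2 * (1 + s)) ^ 2 - 1 / (1 + s)
      = s ^ 2 / (2 * (1 + s) ^ 2) := by
    field_simp
    ring
  have : 0 ≤ s ^ 2 / (2 * (1 + s) ^ 2) := by positivity
  linarith

/-- The subgradient inequality at `x_i + d`, evaluated at `x_i`: along an inexact Newton direction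
`d`, the change of `g_i` plus the linearized change of `f` is at most `-(1 - η) λ ^ 2`. -/
theorem realVal_add_le_of_isInexactDirection {M η : ℝ} (hf : IsSelfConcordant M f)
    {x : BlockVec N} (hx : x ∈ dom (objective f g))
    (hpos : ∀ u : BlockVec N, u ≠ 0 → 0 < inner ℝ u (hess f x u)) {i : Fin n} {d : Block N i}
    (hd : IsInexactDirection f g η x i d) :
    x i + d ∈ dom (g i) ∧ realVal (g i) (x i + d) ≤ realVal (g i) (x i)
      - inner ℝ (grad f x) (embed i d) - (1 - η) * blockNorm f x i d ^ 2 := by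
  obtain ⟨hxf, hxg⟩ := mem_dom_objective.1 hx
  obtain ⟨v, ⟨s, hs, heq⟩, hv⟩ := hd
  refine ⟨hs.1, ?_⟩
  have hsub := subdiff_le hs (hxg i)
  have hseq : s = -v - (grad f x) i - blockHess f x i d := by rw [heq]; abel
  have e1 : x i - (x i + d) = -d := by abel
  rw [e1, inner_neg_right, hseq, inner_sub_left, inner_sub_left, inner_neg_left,
    real_inner_comm d (blockHess f x i d), ← sq_blockNorm hpos] at hsub
  have hCS := abs_le.1 (abs_inner_le_blockDualNorm_mul hf hxf hpos i v d)
  have h2 := mul_le_mul_of_nonneg_right hv (blockNorm_nonneg f x i d)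
  rw [real_inner_comm, inner_embed_left, real_inner_comm]
  nlinarith [hCS.1]

/-- Sufficient decrease: a damped step stays in the domain of `F` and decreases `F` by at least
`λ ^ 2 / (4 (1 + λ))`, where `λ` is the local norm of the direction. -/
theorem blockStep_decrease {η : ℝ} (hη : η ≤ 1 / 4) (hf : IsStandardSelfConcordant f)
    (hg : ∀ i, IsClosedConvex (g i)) {x : BlockVec N} (hx : x ∈ dom (objective f g))
    (hpos : ∀ u : BlockVec N, u ≠ 0 → 0 < inner ℝ u (hess f x u)) {i : Fin n} {d : Block N i}
    (hd : IsInexactDirection f g η x i d) :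
    blockStep f x i d ∈ dom (objective f g) ∧
      realVal (objective f g) (blockStep f x i d) ≤ realVal (objective f g) x
        - 1 / 4 * (blockNorm f x i d ^ 2 / (1 + blockNorm f x i d)) := by
  have hf' : IsSelfConcordant 2 f := hf
  obtain ⟨hxf, hxg⟩ := mem_dom_objective.1 hx
  obtain ⟨hdg, hmodel⟩ := realVal_add_le_of_isInexactDirection hf' hx hpos hd
  rw [blockStep_eq_add]
  set l := blockNorm f x i d with hl
  have hl0 : 0 ≤ l := blockNorm_nonneg f x i d
  have hl1 : 0 < 1 + l := by positivity
  set α := 1 / (1 + l) with hα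
  have hα0 : 0 ≤ α := by positivity
  have hα1 : α ≤ 1 := by
    rw [hα, div_le_one hl1]; linarith
  have hαl : α * l = l / (1 + l) := by rw [hα]; ring
  have hr1 : α * l < 1 := by
    rw [hαl, div_lt_one hl1]; linarith
  have hquad : iteratedDeriv 2 (fun t : ℝ => realVal f (x + t • embed i (α • d))) 0
      ≤ (α * l) ^ 2 := by
    rw [iteratedDeriv_two_line hf' hxf, ← inner_blockHess, map_smul, real_inner_smul_left,
      real_inner_smul_right, ← sq_blockNorm hpos, ← hl]
    exact le_of_eq (by ring)
  obtain ⟨hdomf, hfle⟩ := dikin hf hxf (by positivity) hr1 hquad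
  have hder : deriv (fun t : ℝ => realVal f (x + t • embed i (α • d))) 0
      = α * inner ℝ (grad f x) (embed i d) := by
    have := hasDerivAt_line hf' x (embed i (α • d)) (t := 0) (by simpa [lineDom] using hxf)
    rw [this.deriv, zero_smul, add_zero, embed_smul, real_inner_smul_right]
  rw [hder] at hfle
  have hcomb : x i + α • d = (1 - α) • x i + α • (x i + d) := by module
  have hdomg : x i + α • d ∈ dom (g i) := by
    rw [hcomb]
    exact (hg i).convexOn.1 (hxg i) hdg (by linarith) hα0 (by ring)
  have hgle : realVal (g i) (x i + α • d)
      ≤ (1 - α) * realVal (g i) (x i) + α * realVal (g i) (x i + d) := by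
    rw [hcomb]
    exact (hg i).convexOn.2 (hxg i) hdg (by linarith) hα0 (by ring)
  obtain ⟨hstep, hval⟩ := realVal_separable_add_embed hxg i hdomg
  have hdom : x + embed i (α • d) ∈ dom (objective f g) := mem_dom_objective.2 ⟨hdomf, hstep⟩
  refine ⟨hdom, ?_⟩
  rw [realVal_objective hdom, realVal_objective hx, hval]
  have hlog : Real.log (1 - α * l) = -Real.log (1 + l) := by
    rw [← Real.log_inv, hαl]
    congr 1
    field_simp
    ring
  rw [hlog] at hfle
  -- The decrease is `(1 - η) λ² / (1 + λ) + λ / (1 + λ) - log (1 + λ) = ω(λ) - η λ² / (1 + λ)`.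
  have hω := log_one_add_le hl0
  have hmodel' := mul_le_mul_of_nonneg_left hmodel hα0
  have e1 : α * l ^ 2 = l ^ 2 / (1 + l) := by rw [hα]; ring
  have e2 : l ^ 2 / (2 * (1 + l)) = α * l ^ 2 / 2 := by rw [hα]; field_simp
  have e3 : α * l = l - α * l ^ 2 := by rw [hα]; field_simp; ring
  have e4 : η * (α * l ^ 2) ≤ 1 / 4 * (α * l ^ 2) :=
    mul_le_mul_of_nonneg_right hη (by positivity)
  rw [← e1]
  rw [e2] at hω
  linarith

/-! ### The optimality gap is bounded by the local norms of the directions -/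

/-- A continuous family of operators that are positive definite on a compact set `S` has
quadratic forms uniformly equivalent to the squared norm on `S`. -/
theorem exists_quadratic_bounds {E : Type*} [NormedAddCommGroup E] [InnerProductSpace ℝ E]
    [FiniteDimensional ℝ E] {H : E → E →L[ℝ] E} {S : Set E} (hS : IsCompact S)
    (hH : ContinuousOn H S) (hpos : ∀ x ∈ S, ∀ u : E, u ≠ 0 → 0 < inner ℝ u (H x u)) :
    ∃ m K : ℝ, 0 < m ∧ 0 < K ∧ ∀ x ∈ S, ∀ u : E,
      m * ‖u‖ ^ 2 ≤ inner ℝ u (H x u) ∧ inner ℝ u (H x u) ≤ K * ‖u‖ ^ 2 := by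
  have : ProperSpace E := FiniteDimensional.proper ℝ E
  have hcont : ContinuousOn (fun q : E × E => (inner ℝ q.2 (H q.1 q.2) : ℝ))
      (S ×ˢ Metric.sphere 0 1) := by
    have h1 : ContinuousOn (fun q : E × E => H q.1) (S ×ˢ Metric.sphere 0 1) :=
      hH.comp continuousOn_fst fun q hq => hq.1
    exact continuousOn_snd.inner (h1.clm_apply continuousOn_snd)
  have hcomp : IsCompact (S ×ˢ Metric.sphere (0 : E) 1) := hS.prod (isCompact_sphere 0 1)
  have hmem : ∀ x ∈ S, ∀ u : E, u ≠ 0 → (x, ‖u‖⁻¹ • u) ∈ S ×ˢ Metric.sphere (0 : E) 1 :=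
    fun x hx u hu => ⟨hx, by simp [norm_smul, hu]⟩
  by_cases hne : (S ×ˢ Metric.sphere (0 : E) 1).Nonempty
  · obtain ⟨a, ha, hmin⟩ := hcomp.exists_isMinOn hne hcont
    obtain ⟨b, hb, hmax⟩ := hcomp.exists_isMaxOn hne hcont
    have hunit : ∀ q ∈ S ×ˢ Metric.sphere (0 : E) 1, 0 < (inner ℝ q.2 (H q.1 q.2) : ℝ) :=
      fun q hq => hpos q.1 hq.1 q.2 fun h => by simpa [h] using hq.2
    refine ⟨_, _, hunit a ha, hunit b hb, fun x hx u => ?_⟩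
    by_cases hu : u = 0
    · simp [hu]
    have heq : inner ℝ (‖u‖⁻¹ • u) (H x (‖u‖⁻¹ • u)) * ‖u‖ ^ 2 = inner ℝ u (H x u) := by
      have : ‖u‖ ≠ 0 := norm_ne_zero_iff.2 hu
      rw [map_smul, real_inner_smul_left, real_inner_smul_right]
      field_simp
    rw [← heq]
    exact ⟨mul_le_mul_of_nonneg_right (isMinOn_iff.1 hmin _ (hmem x hx u hu)) (sq_nonneg _),
      mul_le_mul_of_nonneg_right (isMaxOn_iff.1 hmax _ (hmem x hx u hu)) (sq_nonneg _)⟩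
  · refine ⟨1, 1, one_pos, one_pos, fun x hx u => ?_⟩
    by_cases hu : u = 0
    · simp [hu]
    · exact absurd ⟨_, hmem x hx u hu⟩ hne

/-- On the level set, `F x - F x*` is at most a constant times the sum of the local norms of the
inexact directions at `x`. The gradient inequality for `f` and the subgradients at `x_i + d_i`
for `g_i` bound the gap blockwise; compactness bounds the gradient and the Hessian, and the
Lipschitz condition bounds `g_i(x_i) - g_i(x_i + d_i)`. -/
theorem exists_gap_le {η : ℝ} (hη : η ∈ Set.Icc (0 : ℝ) (1 / 4))
    (hf : IsStandardSelfConcordant f) (hg : ∀ i, IsClosedConvex (g i))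
    (hpos : ∀ x ∈ dom (objective f g), ∀ u : BlockVec N, u ≠ 0 → 0 < inner ℝ u (hess f x u))
    {xstar x0 : BlockVec N} (hstar : xstar ∈ dom (objective f g))
    (hx0 : x0 ∈ dom (objective f g)) (hcomp : IsCompact (levelSet f g x0)) {L : NNReal}
    (hLip : LipschitzOnWith L (realVal (separable g)) (levelSet f g x0)) :
    ∃ C : ℝ, 0 < C ∧ ∀ x ∈ levelSet f g x0, ∀ d : ∀ i, Block N i,
      (∀ i, IsInexactDirection f g η x i (d i)) →
      realVal (objective f g) x - realVal (objective f g) xstar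
        ≤ C * ∑ i, blockNorm f x i (d i) := by
  have hf' : IsSelfConcordant 2 f := hf
  have hSF : levelSet f g x0 ⊆ dom (objective f g) := fun x hx =>
    ((le_iff_realVal_le hx0).1 hx).1
  have hSf : levelSet f g x0 ⊆ dom f := fun x hx => (mem_dom_objective.1 (hSF hx)).1
  obtain ⟨m, K, hm, hK, hmK⟩ := exists_quadratic_bounds hcomp
    ((continuousOn_hess hf').mono hSf) fun x hx => hpos x (hSF hx)
  obtain ⟨G, hG⟩ := hcomp.exists_bound_of_continuousOn
    ((contDiffOn_grad hf').continuousOn.mono hSf)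
  obtain ⟨R, hR⟩ := hcomp.exists_bound_of_continuousOn
    (continuousOn_id.sub continuousOn_const : ContinuousOn (fun x => x - xstar) _)
  set C := 2 * √K * |R| + (|G| + L) / √m + 1 with hC
  have hsm : 0 < √m := Real.sqrt_pos.2 hm
  refine ⟨C, by positivity, fun x hx d hd => ?_⟩
  obtain ⟨hxf, hxg⟩ := mem_dom_objective.1 (hSF hx)
  obtain ⟨hsf, hsg⟩ := mem_dom_objective.1 hstar
  have hp := hpos x (hSF hx)
  have hgrad := realVal_add_inner_grad_le hf' hxf hsf
  -- the contribution of each block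
  have hblock : ∀ i, realVal (g i) (x i) - realVal (g i) (xstar i)
      - inner ℝ ((grad f x) i) (xstar i - x i) ≤ C * blockNorm f x i (d i) := by
    intro i
    set l := blockNorm f x i (d i) with hl
    have hl0 : 0 ≤ l := blockNorm_nonneg f x i (d i)
    have hnorm : ∀ y : Block N i, blockNorm f x i y ≤ √K * ‖y‖ ∧ √m * ‖y‖ ≤ blockNorm f x i y := by
      intro y
      have h := hmK x hx (embed i y)
      rw [norm_embed, ← inner_blockHess] at h
      constructor
      · calc blockNorm f x i y ≤ √(K * ‖y‖ ^ 2) := Real.sqrt_le_sqrt h.2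
          _ = √K * ‖y‖ := by rw [Real.sqrt_mul hK.le, Real.sqrt_sq (norm_nonneg _)]
      · calc √m * ‖y‖ = √(m * ‖y‖ ^ 2) := by
              rw [Real.sqrt_mul hm.le, Real.sqrt_sq (norm_nonneg _)]
          _ ≤ blockNorm f x i y := Real.sqrt_le_sqrt h.1
    have hdl : ‖d i‖ ≤ l / √m := by
      rw [le_div_iff₀ hsm, mul_comm]
      exact (hnorm _).2
    -- the decrease of `g_i` along the full direction, through the damped step
    have hgdec : realVal (g i) (x i) - realVal (g i) (x i + d i) ≤ L * ‖d i‖ := by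
      obtain ⟨hstep, hdec⟩ := blockStep_decrease hη.2 hf hg (hSF hx) hp (hd i)
      have hdg := (realVal_add_le_of_isInexactDirection hf' (hSF hx) hp (hd i)).1
      have hmem : blockStep f x i (d i) ∈ levelSet f g x0 := by
        refine (le_iff_realVal_le hx0).2 ⟨hstep, hdec.trans ?_⟩
        have := ((le_iff_realVal_le hx0).1 hx).2
        have : 0 ≤ 1 / 4 * (blockNorm f x i (d i) ^ 2 / (1 + blockNorm f x i (d i))) := by
          positivity
        linarith
      have hlip := hLip.dist_le_mul x hx _ hmem
      rw [blockStep_eq_add, ← hl] at hlip hstep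
      set α := 1 / (1 + l) with hα
      have hα0 : 0 < α := by positivity
      have hα1 : α ≤ 1 := by
        rw [hα, div_le_one (by positivity)]; linarith
      have hdomg := (mem_dom_objective.1 hstep).2 i
      rw [add_embed_apply_self] at hdomg
      rw [(realVal_separable_add_embed hxg i hdomg).2, dist_self_add_right,
        dist_self_add_right, Real.norm_eq_abs, norm_embed, norm_smul, Real.norm_of_nonneg hα0.le] at hlip
      have hcomb : x i + α • d i = (1 - α) • x i + α • (x i + d i) := by module
      have hgle : realVal (g i) (x i + α • d i)
          ≤ (1 - α) * realVal (g i) (x i) + α * realVal (g i) (x i + d i) := by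
        rw [hcomb]
        exact (hg i).convexOn.2 (hxg i) hdg (by linarith) hα0.le (by ring)
      have := neg_abs_le (realVal (g i) (x i + α • d i) - realVal (g i) (x i))
      refine le_of_mul_le_mul_left ?_ hα0
      linarith
    obtain ⟨v, ⟨s, hs, heq⟩, hv⟩ := hd i
    have hsub := subdiff_le hs (hsg i)
    have hseq : s = -v - (grad f x) i - blockHess f x i (d i) := by rw [heq]; abel
    obtain ⟨y, hy⟩ : ∃ y, y = x i - xstar i := ⟨_, rfl⟩
    have e1 : xstar i - (x i + d i) = -y - d i := by rw [hy]; abel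
    have e2 : xstar i - x i = -y := by rw [hy]; abel
    rw [e1, hseq] at hsub
    rw [e2, inner_neg_right]
    simp only [inner_sub_left, inner_sub_right, inner_neg_left, inner_neg_right] at hsub
    have hvd := (abs_le.1 (abs_inner_le_blockDualNorm_mul hf' hxf hp i v (d i))).1
    have hvy := (abs_le.1 (abs_inner_le_blockDualNorm_mul hf' hxf hp i v y)).1
    have hHy := (abs_le.1 (abs_inner_blockHess_le hf' hxf hp i y (d i))).1
    have hHd := sq_blockNorm hp i (d i)
    rw [real_inner_comm] at hHy hHd
    rw [← hl] at hvd hHy hHd hv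
    have hyR : ‖y‖ ≤ |R| := by
      have h1 : ‖(x - xstar) i‖ ≤ ‖x - xstar‖ := PiLp.norm_apply_le (x - xstar) i
      rw [hy]
      exact h1.trans ((hR x hx).trans (le_abs_self R))
    have hgd : -(|G| * ‖d i‖) ≤ inner ℝ ((grad f x) i) (d i) := by
      have h1 := (abs_le.1 (abs_real_inner_le_norm ((grad f x) i) (d i))).1
      have h2 : ‖(grad f x) i‖ ≤ ‖grad f x‖ := PiLp.norm_apply_le (grad f x) i
      have h3 := h2.trans ((hG x hx).trans (le_abs_self G))
      have := mul_le_mul_of_nonneg_right h3 (norm_nonneg (d i))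
      linarith
    have hvl : blockDualNorm f x i v ≤ l := hv.trans (by nlinarith [hη.2])
    have hyK : blockNorm f x i y ≤ √K * |R| :=
      (hnorm y).1.trans (mul_le_mul_of_nonneg_left hyR (Real.sqrt_nonneg _))
    -- The error term `-⟨v, d⟩ ≤ η λ² ≤ λ²` is absorbed by `-⟨d, H d⟩ = -λ²`.
    have b1 : blockDualNorm f x i v * l ≤ l ^ 2 := by nlinarith
    have b2 : blockDualNorm f x i v * blockNorm f x i y ≤ l * (√K * |R|) :=
      mul_le_mul hvl hyK (blockNorm_nonneg _ _ _ _) hl0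
    have b3 : blockNorm f x i y * l ≤ √K * |R| * l := mul_le_mul_of_nonneg_right hyK hl0
    have b4 : (|G| + L) * ‖d i‖ ≤ (|G| + L) * (l / √m) :=
      mul_le_mul_of_nonneg_left hdl (by positivity)
    have b5 : C * l = 2 * (l * (√K * |R|)) + (|G| + L) * (l / √m) + l := by rw [hC]; ring
    rw [b5]
    linarith
  rw [realVal_objective (hSF hx), realVal_objective hstar, realVal_separable hxg,
    realVal_separable hsg, Finset.mul_sum]
  have hsum := Finset.sum_le_sum fun i (_ : i ∈ Finset.univ) => hblock i
  rw [Finset.sum_sub_distrib, Finset.sum_sub_distrib] at hsum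
  have hinner : inner ℝ (grad f x) (xstar - x) = ∑ i, inner ℝ ((grad f x) i) (xstar i - x i) :=
    PiLp.inner_apply _ _
  linarith

/-! ### Averages over the random history -/

section Average

variable {Ω : Type*}

/-- The history is a function of the finitely many picks that it records. -/
theorem exists_history_eq (idx : ℕ → Ω → Fin n) (k : ℕ) :
    ∃ φ : (Finset.range k → Fin n) → List (Fin n),
      ∀ ω, history idx ω k = φ fun j => idx j ω := by
  induction k with
  | zero => exact ⟨fun _ => [], fun ω => rfl⟩
  | succ k ih =>
    obtain ⟨φ, hφ⟩ := ih
    refine ⟨fun t => t ⟨k, Finset.self_mem_range_succ k⟩ ::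
      φ fun j => t ⟨j, Finset.range_subset_range.2 k.le_succ j.2⟩, fun ω => ?_⟩
    rw [history, hφ]

variable [MeasurableSpace Ω] {P : Measure Ω} [IsProbabilityMeasure P] {idx : ℕ → Ω → Fin n}

theorem measurable_history (hidx : ∀ k, Measurable (idx k)) (V : List (Fin n) → ℝ) (k : ℕ) :
    Measurable fun ω => V (history idx ω k) := by
  obtain ⟨φ, hφ⟩ := exists_history_eq idx k
  simp only [hφ]
  exact (Measurable.of_discrete (f := fun t => V (φ t))).comp
    (measurable_pi_lambda _ fun j => hidx j)

theorem integrable_history (hidx : ∀ k, Measurable (idx k)) (V : List (Fin n) → ℝ) (k : ℕ) :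
    Integrable (fun ω => V (history idx ω k)) P := by
  obtain ⟨φ, hφ⟩ := exists_history_eq idx k
  obtain ⟨C, hC⟩ := (Set.finite_range fun t => ‖V (φ t)‖).bddAbove
  refine Integrable.of_bound (measurable_history hidx V k).aestronglyMeasurable C
    (Eventually.of_forall fun ω => ?_)
  rw [hφ]
  exact hC ⟨_, rfl⟩

/-- The tower property of the method: the `k`-th pick is independent of the history before it. -/
theorem integral_history_succ (hidx : ∀ k, Measurable (idx k)) (hindep : iIndepFun idx P)
    {p : Fin n → ℝ} (hlaw : ∀ k i, P.real {ω | idx k ω = i} = p i) (V : List (Fin n) → ℝ)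
    (k : ℕ) :
    ∫ ω, V (history idx ω (k + 1)) ∂P = ∫ ω, ∑ i, p i * V (i :: history idx ω k) ∂P := by
  have hterm : ∀ i, ∫ ω, {ω | idx k ω = i}.indicator 1 ω * V (i :: history idx ω k) ∂P
      = p i * ∫ ω, V (i :: history idx ω k) ∂P := by
    intro i
    have hind : IndepFun (fun ω => ({ω | idx k ω = i}.indicator 1 ω : ℝ))
        (fun ω => V (i :: history idx ω k)) P := by
      obtain ⟨φ, hφ⟩ := exists_history_eq idx k
      have h := hindep.indepFun_finset {k} (Finset.range k) (by simp) hidx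
      have h' := h.comp
        (φ := fun t => ({j : Fin n | j = i}.indicator 1 (t ⟨k, by simp⟩) : ℝ))
        (ψ := fun t => V (i :: φ t)) Measurable.of_discrete Measurable.of_discrete
      simp only [hφ]
      exact h'
    have hm : MeasurableSet {ω | idx k ω = i} := hidx k (measurableSet_singleton i)
    rw [hind.integral_fun_mul_eq_mul_integral
      ((measurable_one.indicator hm).aestronglyMeasurable)
      (measurable_history hidx (fun h => V (i :: h)) k).aestronglyMeasurable,
      integral_indicator_one hm, hlaw]
  have hint : ∀ i, Integrable (fun ω => V (i :: history idx ω k)) P :=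
    fun i => integrable_history hidx (fun h => V (i :: h)) k
  rw [integral_finsetSum _ fun i _ => (hint i).const_mul (p i)]
  simp only [integral_const_mul, ← hterm]
  rw [← integral_finsetSum]
  · refine integral_congr_ae (Eventually.of_forall fun ω => ?_)
    simp [history, Set.indicator_apply]
  · intro i _
    have hm : MeasurableSet {ω | idx k ω = i} := hidx k (measurableSet_singleton i)
    have : (fun ω => ({ω | idx k ω = i}.indicator 1 ω : ℝ) * V (i :: history idx ω k))
        = {ω | idx k ω = i}.indicator fun ω => V (i :: history idx ω k) := by
      funext ω
      by_cases h : idx k ω = i <;> simp [h]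
    rw [this]
    exact (hint i).indicator hm

/-- A nonnegative sequence with `a (k + 1) ≤ a k - c (a k) ^ 2` tends to zero. -/
theorem tendsto_zero_of_le_sub_sq {a : ℕ → ℝ} {c : ℝ} (hc : 0 < c) (ha : ∀ k, 0 ≤ a k)
    (h : ∀ k, a (k + 1) ≤ a k - c * a k ^ 2) : Tendsto a atTop (𝓝 0) := by
  have hanti : Antitone a := antitone_nat_of_succ_le fun k => by
    have : 0 ≤ c * a k ^ 2 := by positivity
    linarith [h k]
  have hlim := tendsto_atTop_ciInf hanti ⟨0, by rintro _ ⟨k, rfl⟩; exact ha k⟩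
  set l := ⨅ k, a k
  have hle : l ≤ l - c * l ^ 2 :=
    le_of_tendsto_of_tendsto' (hlim.comp (tendsto_add_atTop_nat 1))
      (hlim.sub ((hlim.pow 2).const_mul c)) h
  have hl : l = 0 := by
    have : l ^ 2 ≤ 0 := by nlinarith
    exact pow_eq_zero_iff two_ne_zero |>.1 (le_antisymm this (sq_nonneg l))
  rwa [hl] at hlim

/-- If the conditional mean of a potential `V ≥ 0` drops by `c V ^ 2` at each step, then its mean
tends to zero: by Jensen's inequality the means satisfy `a (k + 1) ≤ a k - c (a k) ^ 2`. -/
theorem tendsto_integral_history (hidx : ∀ k, Measurable (idx k)) (hindep : iIndepFun idx P)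
    {p : Fin n → ℝ} (hlaw : ∀ k i, P.real {ω | idx k ω = i} = p i) {V : List (Fin n) → ℝ}
    (hV : ∀ h, 0 ≤ V h) {c : ℝ} (hc : 0 < c)
    (hdec : ∀ h, ∑ i, p i * V (i :: h) ≤ V h - c * V h ^ 2) :
    Tendsto (fun k => ∫ ω, V (history idx ω k) ∂P) atTop (𝓝 0) := by
  refine tendsto_zero_of_le_sub_sq hc (fun k => integral_nonneg fun ω => hV _) fun k => ?_
  rw [integral_history_succ hidx hindep hlaw]
  set m := ∫ ω, V (history idx ω k) ∂P with hm
  have hint := integrable_history (P := P) hidx V k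
  -- the tangent `2 m V - m ^ 2 ≤ V ^ 2` of the square at the mean
  have hle : ∫ ω, ∑ i, p i * V (i :: history idx ω k) ∂P
      ≤ ∫ ω, ((1 - 2 * c * m) * V (history idx ω k) + c * m ^ 2) ∂P := by
    refine integral_mono (integrable_history hidx (fun h => ∑ i, p i * V (i :: h)) k)
      ((hint.const_mul _).add (integrable_const _)) fun ω => ?_
    refine (hdec _).trans ?_
    have : 0 ≤ c * (V (history idx ω k) - m) ^ 2 := by positivity
    linarith
  refine hle.trans (le_of_eq ?_)
  rw [integral_add (hint.const_mul _) (integrable_const _), integral_const_mul, ← hm]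
  simp
  ring

end Average

/-! ### Expected decrease and convergence -/

/-- If the gap `δ ≤ Δ` is at most `C ∑ λ_i`, then some `λ_i` is at least `δ / (n C)`, and the mean
of `λ_i ^ 2 / (1 + λ_i)` is at least a constant times `δ ^ 2`. -/
theorem exists_sq_le_weighted_sum {p : Fin n → ℝ} (hp : ∀ i, 0 < p i) {C Δ : ℝ} (hC : 0 < C)
    (hΔ : 0 ≤ Δ) : ∃ c : ℝ, 0 < c ∧ ∀ (δ : ℝ) (l : Fin n → ℝ), 0 ≤ δ → δ ≤ Δ → (∀ i, 0 ≤ l i) →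
      δ ≤ C * ∑ i, l i → c * δ ^ 2 ≤ ∑ i, p i * (l i ^ 2 / (1 + l i)) := by
  rcases Nat.eq_zero_or_pos n with hn | hn
  · subst hn
    refine ⟨1, one_pos, fun δ l hδ _ _ h => ?_⟩
    have : δ = 0 := le_antisymm (by simpa using h) hδ
    simp [this]
  have : Nonempty (Fin n) := ⟨⟨0, hn⟩⟩
  have hn' : (0 : ℝ) < n := by exact_mod_cast hn
  obtain ⟨i0, hi0⟩ := Finite.exists_min p
  set D := (n : ℝ) * C with hD
  have hD0 : 0 < D := by positivity
  have hpi := hp i0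
  refine ⟨p i0 * (1 / (D ^ 2 * (1 + Δ / D))), by positivity, fun δ l hδ hδΔ hl hle => ?_⟩
  obtain ⟨i, -, hi⟩ : ∃ i ∈ Finset.univ, δ / D ≤ l i := by
    refine Finset.exists_le_of_sum_le Finset.univ_nonempty ?_
    rw [Finset.sum_const, Finset.card_univ, Fintype.card_fin, nsmul_eq_mul, hD]
    calc (n : ℝ) * (δ / (n * C)) = δ / C := by field_simp
      _ ≤ ∑ i, l i := by rw [div_le_iff₀ hC]; linarith
  have hnn : ∀ j, 0 ≤ l j ^ 2 / (1 + l j) := fun j => by have := hl j; positivity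
  have h1 : p i0 * (l i ^ 2 / (1 + l i)) ≤ ∑ i, p i * (l i ^ 2 / (1 + l i)) :=
    (mul_le_mul_of_nonneg_right (hi0 i) (hnn i)).trans
      (Finset.single_le_sum (f := fun i => p i * (l i ^ 2 / (1 + l i)))
        (fun j _ => mul_nonneg (hp j).le (hnn j)) (Finset.mem_univ i))
  refine le_trans ?_ h1
  rw [mul_assoc]
  refine mul_le_mul_of_nonneg_left ?_ hpi.le
  have hε : 0 ≤ δ / D := by positivity
  have hli := hl i
  calc 1 / (D ^ 2 * (1 + Δ / D)) * δ ^ 2 = (δ / D) ^ 2 / (1 + Δ / D) := by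
        field_simp
    _ ≤ (δ / D) ^ 2 / (1 + δ / D) := by
        apply div_le_div_of_nonneg_left (by positivity) (by positivity)
        gcongr
    _ ≤ l i ^ 2 / (1 + l i) := by
        rw [div_le_div_iff₀ (by positivity) (by positivity)]
        nlinarith [mul_le_mul hi hi hε hli, mul_nonneg (mul_nonneg hε hli) (sub_nonneg.2 hi)]

/-- Every iterate of the method lies in the level set of the starting point. -/
theorem iterate_mem_levelSet {η : ℝ} (hη : η ≤ 1 / 4) (hf : IsStandardSelfConcordant f)
    (hg : ∀ i, IsClosedConvex (g i))
    (hpos : ∀ x ∈ dom (objective f g), ∀ u : BlockVec N, u ≠ 0 → 0 < inner ℝ u (hess f x u))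
    {x0 : BlockVec N} (hx0 : x0 ∈ dom (objective f g)) {d : List (Fin n) → ∀ i, Block N i}
    (hd : ∀ h i, IsInexactDirection f g η (iterate f x0 d h) i (d h i)) (h : List (Fin n)) :
    iterate f x0 d h ∈ levelSet f g x0 := by
  induction h with
  | nil => exact le_refl (objective f g x0)
  | cons i h ih =>
    obtain ⟨hdom, hle⟩ := (le_iff_realVal_le hx0).1 ih
    obtain ⟨hstep, hdec⟩ := blockStep_decrease hη hf hg hdom (hpos _ hdom) (hd h i)
    refine (le_iff_realVal_le hx0).2 ⟨hstep, hdec.trans ?_⟩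
    have hl := blockNorm_nonneg f (iterate f x0 d h) i (d h i)
    have : 0 ≤ 1 / 4 * (blockNorm f (iterate f x0 d h) i (d h i) ^ 2
      / (1 + blockNorm f (iterate f x0 d h) i (d h i))) := by positivity
    linarith

end RBPDN

theorem theorem4p1 {n : ℕ} {N : Fin n → ℕ}
    -- the problem data
    (f : RBPDN.BlockVec N → WithTop ℝ) (g : ∀ i, RBPDN.Block N i → WithTop ℝ)
    (hf : RBPDN.IsStandardSelfConcordant f)
    (hg : ∀ i, RBPDN.IsProperClosedConvex (g i))
    (hpos : ∀ x ∈ RBPDN.dom (RBPDN.objective f g), ∀ u : RBPDN.BlockVec N, u ≠ 0 →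
      0 < inner ℝ u (RBPDN.hess f x u))
    (xstar : RBPDN.BlockVec N)
    (hstar : RBPDN.IsUniqueMinimizer (RBPDN.objective f g) xstar)
    -- the input of the method
    (x0 : RBPDN.BlockVec N) (hx0 : x0 ∈ RBPDN.dom (RBPDN.objective f g))
    (η : ℝ) (hη : η ∈ Set.Icc (0 : ℝ) (1 / 4))
    (p : Fin n → ℝ) (hp : ∀ i, 0 < p i) (hpsum : ∑ i, p i = 1)
    -- the random choice of the blocks
    {Ω : Type*} [MeasurableSpace Ω] (P : Measure Ω) [IsProbabilityMeasure P]
    (idx : ℕ → Ω → Fin n) (hidx : ∀ k, Measurable (idx k)) (hindep : iIndepFun idx P)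
    (hlaw : ∀ k i, P.real {ω | idx k ω = i} = p i)
    -- the approximate solutions of the subproblems
    (d : List (Fin n) → ∀ i : Fin n, RBPDN.Block N i)
    (hd : ∀ h i, RBPDN.IsInexactDirection f g η (RBPDN.iterate f x0 d h) i (d h i))
    -- the assumption of the theorem
    (hLip : ∃ L : NNReal,
      LipschitzOnWith L (RBPDN.realVal (RBPDN.separable g)) (RBPDN.levelSet f g x0)) :
    (∀ k ω, RBPDN.iterate f x0 d (RBPDN.history idx ω k) ∈ RBPDN.dom (RBPDN.objective f g)) ∧
    (∀ k, Integrable (fun ω => RBPDN.realVal (RBPDN.objective f g)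
      (RBPDN.iterate f x0 d (RBPDN.history idx ω k))) P) ∧
    Tendsto (fun k => ∫ ω, RBPDN.realVal (RBPDN.objective f g)
        (RBPDN.iterate f x0 d (RBPDN.history idx ω k)) ∂P)
      atTop (𝓝 (RBPDN.realVal (RBPDN.objective f g) xstar)) := by
  open RBPDN in
  have hf' : IsSelfConcordant 2 f := hf
  have hg' : ∀ i, IsClosedConvex (g i) := fun i => (hg i).toIsClosedConvex
  have hlevel := iterate_mem_levelSet hη.2 hf hg' hpos hx0 hd
  have hdom : ∀ h, iterate f x0 d h ∈ dom (objective f g) := fun h =>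
    ((le_iff_realVal_le hx0).1 (hlevel h)).1
  have hint : ∀ k, Integrable (fun ω => realVal (objective f g)
      (iterate f x0 d (history idx ω k))) P :=
    integrable_history hidx fun h => realVal (objective f g) (iterate f x0 d h)
  refine ⟨fun k ω => hdom _, hint, ?_⟩
  obtain ⟨hmin, huniq⟩ := hstar
  have hsdom : xstar ∈ dom (objective f g) := ((le_iff_realVal_le hx0).1 (hmin x0)).1
  have hge : ∀ x ∈ dom (objective f g),
      realVal (objective f g) xstar ≤ realVal (objective f g) x := fun x hx =>
    ((le_iff_realVal_le hx).1 (hmin x)).2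
  have hcomp : IsCompact (levelSet f g x0) := by
    have := isCompact_sublevel (lowerSemicontinuous_objective hf'.toIsClosedConvex hg')
      (convexOn_objective hf'.toIsClosedConvex hg') hsdom hmin huniq
      (realVal (objective f g) x0)
    rwa [coe_realVal hx0] at this
  obtain ⟨L, hL⟩ := hLip
  obtain ⟨C, hC, hgap⟩ := exists_gap_le hη hf hg' hpos hsdom hx0 hcomp hL
  obtain ⟨c, hc, hsq⟩ := exists_sq_le_weighted_sum hp hC (sub_nonneg.2 (hge x0 hx0))
  have hlim := tendsto_integral_history hidx hindep hlaw
    (V := fun h => realVal (objective f g) (iterate f x0 d h) - realVal (objective f g) xstar)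
    (fun h => sub_nonneg.2 (hge _ (hdom h))) (c := 1 / 4 * c) (by positivity) fun h => by
      set x := iterate f x0 d h with hx
      have h1 := hsq _ (fun i => blockNorm f x i (d h i)) (sub_nonneg.2 (hge _ (hdom h)))
        (sub_le_sub_right ((le_iff_realVal_le hx0).1 (hlevel h)).2 _)
        (fun i => blockNorm_nonneg _ _ _ _) (hgap x (hlevel h) (d h) (hd h))
      have h2 : ∑ i, p i * (realVal (objective f g) (iterate f x0 d (i :: h))
            - realVal (objective f g) xstar)
          ≤ ∑ i, (p i * (realVal (objective f g) x - realVal (objective f g) xstar)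
            - 1 / 4 * (p i * (blockNorm f x i (d h i) ^ 2 / (1 + blockNorm f x i (d h i))))) := by
        refine Finset.sum_le_sum fun i _ => ?_
        have := (blockStep_decrease hη.2 hf hg' (hdom h) (hpos _ (hdom h)) (hd h i)).2
        have := mul_le_mul_of_nonneg_left this (hp i).le
        simp only [iterate, ← hx] at this ⊢
        linarith
      rw [Finset.sum_sub_distrib, ← Finset.sum_mul, ← Finset.mul_sum, hpsum] at h2
      linarith
  have heq : ∀ k, ∫ ω, (realVal (objective f g) (iterate f x0 d (history idx ω k))
      - realVal (objective f g) xstar) ∂P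
      = ∫ ω, realVal (objective f g) (iterate f x0 d (history idx ω k)) ∂P
        - realVal (objective f g) xstar := fun k => by
    rw [integral_sub (hint k) (integrable_const _)]
    simp
  simp only [heq] at hlim
  simpa using hlim.add_const (realVal (objective f g) xstar)
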